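/- Let $f\colon(\mathbb C^2,0)\to(\mathbb C,0)$ be a complex analytic function germ in the coordinates $(x,y)$, with $f\not\equiv 0$. A Puiseux series is a series $\phi(y)=\sum_{n\ge 0}c_n y^{n/N}$ with complex coefficients, for some integer $N\ge 1$, such that $\sum_n c_n t^n$ has positive radius of convergence; $\mathrm{ord}\,\phi$ denotes the smallest exponent occurring in $\phi$ with a nonzero coefficient ($\mathrm{ord}\,0=+\infty$). A Newton–Puiseux root of a germ $h=0$ is a Puiseux series $\phi$ with $\mathrm{ord}\,\phi>0$ and $h(\phi(y),y)\equiv 0$. Let $\Gamma(f)$ be the set of polar branches of $f$ that are not roots of $f$, that is, of Newton–Puiseux roots of $\partial f/\partial x=0$ that are not Newton–Puiseux roots of $f=0$. Let $\xi_i\ne\xi_j$ be two distinct Newton–Puiseux roots of $f=0$, and let $\rho=\mathrm{ord}(\xi_i-\xi_j)$ be their contact order. Let $\xi_{i,j}$ be their approximation $$\xi_{i,j}(y)=\sum_{\alpha<\rho}a_\alpha y^\alpha+g\,y^\rho,\qquad \xi_i(y)=\sum_\alpha a_\alpha y^\alpha,$$ where $g\in\mathbb C$ is generic. Then there is a polar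 branch $\gamma\in\Gamma(f)$ such that, for all but finitely many $g\in\mathbb C$, $$\mathrm{ord}(\gamma-\xi_k)=\mathrm{ord}(\xi_{i,j}-\xi_k)\quad\text{for all Newton–Puiseux roots }\xi_k\text{ of }f=0.$$ In particular, $\mathrm{ord}(\gamma-\xi_i)=\mathrm{ord}(\gamma-\xi_j)=\mathrm{ord}(\xi_i-\xi_j)$. -/

import Mathlib

open Filter Topology

noncomputable section

/-- `φ(y) = ∑ φ_q y^q` is a convergent Puiseux series in `y^(1/N)`, and `t ↦ (a t, t ^ N)` is the
parametrization of the arc `x = φ(y)`: all exponents of `φ` lie in `(1/N)ℕ`, the power series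
`∑ φ_(n/N) t^n` has positive radius of convergence, and `a` is its sum near `t = 0`. -/
def IsPuiseuxParam (φ : HahnSeries ℚ ℂ) (N : ℕ) (a : ℂ → ℂ) : Prop :=
  0 < N ∧ φ.support ⊆ Set.range (fun n : ℕ => (n : ℚ) / (N : ℚ)) ∧
    HasFPowerSeriesAt a
      (FormalMultilinearSeries.ofScalars ℂ (fun n : ℕ => φ.coeff ((n : ℚ) / (N : ℚ)))) 0

/-- `x = φ(y)` is a Newton–Puiseux root of the germ `h = 0` at the origin: `φ` is a convergent
Puiseux series of positive order with `h (φ(y), y) = 0`. -/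
def IsNewtonPuiseuxRoot (h : ℂ × ℂ → ℂ) (φ : HahnSeries ℚ ℂ) : Prop :=
  0 < φ.orderTop ∧ ∃ (N : ℕ) (a : ℂ → ℂ), IsPuiseuxParam φ N a ∧
    ∀ᶠ t in 𝓝 (0 : ℂ), h (a t, t ^ N) = 0

/-- The partial derivative `∂f/∂x`, where `x` is the first coordinate. -/
def partialX (f : ℂ × ℂ → ℂ) : ℂ × ℂ → ℂ :=
  fun p => deriv (fun x : ℂ => f (x, p.2)) p.1

/-- `Γ(f)`: the polar branches, i.e. Newton–Puiseux roots of `∂f/∂x`, that are not roots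
of `f`. -/
def polarBranches (f : ℂ × ℂ → ℂ) : Set (HahnSeries ℚ ℂ) :=
  {γ | IsNewtonPuiseuxRoot (partialX f) γ ∧ ¬ IsNewtonPuiseuxRoot f γ}

/-- The `ρ`-approximation `∑_{α < ρ} φ_α y^α + g y^ρ` of `φ`, with the constant `g`. -/
def rhoApprox (φ : HahnSeries ℚ ℂ) (ρ : ℚ) (g : ℂ) : HahnSeries ℚ ℂ :=
  HahnSeries.truncLT ρ φ + HahnSeries.single ρ g

/-- The approximation of two distinct series `φ` and `ψ`, with the constant `g`: the
`ρ`-approximation of `φ`, where `ρ = ord (φ - ψ)` is their contact order. -/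
def approxPair (φ ψ : HahnSeries ℚ ℂ) (g : ℂ) : HahnSeries ℚ ℂ :=
  rhoApprox φ (φ - ψ).order g

end

/-! Let `T` be the part of `ξi` below `ρ`. Substituting `x = T(y) + w y^ρ` and dividing by the
largest possible power of `y` leaves `P(w)` at `y = 0`, with `P ≠ 0` a polynomial. Any root of `f`
agreeing with `ξi` below `ρ` has its coefficient at `y^ρ` among the roots of `P`, so `ξi` and `ξj`
give two distinct roots (`exists_dominant_polynomial`). A polynomial with two distinct roots has a
critical point `w` that is not a root (`Polynomial.exists_isRoot_derivative_not_isRoot`), and `w`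
lifts to a root `γ = T + w y^ρ + ...` of `∂f/∂x`. Since `P(w) ≠ 0`, `γ` is not a root of `f` and its
contact with every root agreeing with `ξi` below `ρ` is exactly `ρ`; the same holds for `T + g y^ρ`
whenever `P(g) ≠ 0`. With any other root, the contact is decided below `ρ`, where the two series
coincide. The lifting is Newton–Puiseux (`AnalyticAt.exists_puiseux_branch`), by induction on the
order `d` of `G(x, 0)`. Weierstrass preparation is replaced by finite expansions in `x` with
analytic remainder. -/

/-! ### Division by `x` and expansion of germs in powers of `x` -/

/-- Telescoping: replacing `v` by `(0, v.2)` one slot at a time gives `n + 1` terms, each of norm at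
most `‖f‖`. `F` varies because the induction passes to `f.curryRight`, with values in linear maps.
-/
theorem ContinuousMultilinearMap.exists_apply_sub_apply_eq_fst_smul (n : ℕ) :
    ∀ {F : Type} [NormedAddCommGroup F] [NormedSpace ℂ F]
      (f : ContinuousMultilinearMap ℂ (fun _ : Fin (n + 1) => ℂ × ℂ) F),
      ∃ q : ContinuousMultilinearMap ℂ (fun _ : Fin n => ℂ × ℂ) F,
        ‖q‖ ≤ (n + 1) * ‖f‖ ∧
        ∀ v : ℂ × ℂ, f (fun _ => v) - f (fun _ => (0, v.2)) = v.1 • q (fun _ => v) := by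
  have hsplit (v : ℂ × ℂ) : v = v.1 • ((1, 0) : ℂ × ℂ) + (0, v.2) := by ext <;> simp
  have hone : ‖((1, 0) : ℂ × ℂ)‖ = 1 := by simp [Prod.norm_def]
  induction n with
  | zero =>
    intro F _ _ f
    refine ⟨ContinuousMultilinearMap.constOfIsEmpty ℂ _ (f fun _ => (1, 0)), ?_, fun v => ?_⟩
    · refine ContinuousMultilinearMap.opNorm_le_bound (by positivity) fun m => ?_
      simpa [hone] using f.le_opNorm fun _ => (1, 0)
    · have h := (f.curryLeft.map_add (v.1 • ((1, 0) : ℂ × ℂ)) (0, v.2))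
      rw [← hsplit, map_smul] at h
      have h' := congrArg (fun g => g (fun i : Fin 0 => (0 : ℂ × ℂ))) h
      simp only [ContinuousMultilinearMap.curryLeft_apply, _root_.add_apply,
        _root_.smul_apply] at h'
      have hc (x : ℂ × ℂ) : (Fin.cons x fun i : Fin 0 => (0 : ℂ × ℂ)) = fun _ : Fin 1 => x := by
        funext i
        obtain rfl := Fin.fin_one_eq_zero i
        rfl
      simp only [hc] at h'
      simp [h']
  | succ n ih =>
    intro F _ _ f
    obtain ⟨q, hq, h⟩ := ih f.curryRight
    rw [ContinuousMultilinearMap.curryRight_norm] at hq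
    let π : ℂ × ℂ →L[ℂ] ℂ × ℂ :=
      (ContinuousLinearMap.inr ℂ ℂ ℂ).comp (ContinuousLinearMap.snd ℂ ℂ ℂ)
    have hπ (v : ℂ × ℂ) : π v = (0, v.2) := rfl
    have hπn : ‖π‖ ≤ 1 := ContinuousLinearMap.opNorm_le_bound _ zero_le_one fun v => by
      simp [hπ, Prod.norm_def]
    -- `A` is the term in which the last slot changes; `B` collects the others, with `(0, v.2)`
    -- already in the last slot.
    let A := (ContinuousLinearMap.apply ℂ F ((1, 0) : ℂ × ℂ)).compContinuousMultilinearMap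
      f.curryRight
    let B : ContinuousMultilinearMap ℂ (fun _ : Fin (n + 1) => ℂ × ℂ) F :=
      ContinuousMultilinearMap.uncurryRight (Ei := fun _ => ℂ × ℂ)
        (((ContinuousLinearMap.compL ℂ (ℂ × ℂ) (ℂ × ℂ) F).flip π).compContinuousMultilinearMap q)
    have hA : ‖A‖ ≤ ‖f‖ := by
      refine ContinuousMultilinearMap.opNorm_le_bound (norm_nonneg _) fun m => ?_
      calc ‖A m‖ = ‖f.curryRight m (1, 0)‖ := rfl
        _ ≤ ‖f.curryRight m‖ * ‖((1, 0) : ℂ × ℂ)‖ := ContinuousLinearMap.le_opNorm _ _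
        _ ≤ ‖f‖ * ∏ i, ‖m i‖ := by
          rw [hone, mul_one, ← ContinuousMultilinearMap.curryRight_norm f]
          exact ContinuousMultilinearMap.le_opNorm _ _
    have hB : ‖B‖ ≤ ‖q‖ := by
      rw [ContinuousMultilinearMap.uncurryRight_norm]
      refine ContinuousMultilinearMap.opNorm_le_bound (norm_nonneg _) fun m => ?_
      calc ‖(q m).comp π‖ ≤ ‖q m‖ * ‖π‖ := ContinuousLinearMap.opNorm_comp_le _ _
        _ ≤ ‖q m‖ := mul_le_of_le_one_right (norm_nonneg _) hπn
        _ ≤ _ := ContinuousMultilinearMap.le_opNorm _ _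
    refine ⟨A + B, (norm_add_le _ _).trans ?_, fun v => ?_⟩
    · push_cast
      linarith
    · have hc (x : ℂ × ℂ) :
          f (fun _ => x) = f.curryRight (fun _ => x) x := by
        rw [ContinuousMultilinearMap.curryRight_apply]
        congr 1
        funext i
        refine Fin.lastCases ?_ (fun j => ?_) i <;> simp
      have hAv : A (fun _ => v) = f.curryRight (fun _ => v) (1, 0) := rfl
      have hBv : B (fun _ => v) = q (fun _ => v) (0, v.2) := rfl
      have h1 : f.curryRight (fun _ => v) v
          = v.1 • f.curryRight (fun _ => v) (1, 0) + f.curryRight (fun _ => v) (0, v.2) := by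
        conv_lhs => rw [hsplit v]
        rw [map_add, map_smul, ← hsplit v]
      have h2 := congrArg (fun g => g (0, v.2)) (h v)
      simp only [_root_.sub_apply, _root_.smul_apply] at h2
      rw [hc, hc, h1, _root_.add_apply, hAv, hBv, smul_add, ← h2]
      abel

/-- Division by the first coordinate in the ring of germs of analytic functions. -/
theorem AnalyticAt.exists_eq_add_fst_mul {G : ℂ × ℂ → ℂ} (hG : AnalyticAt ℂ G 0) :
    ∃ R : ℂ × ℂ → ℂ, AnalyticAt ℂ R 0 ∧
      ∀ᶠ v in 𝓝 (0 : ℂ × ℂ), G v = G (0, v.2) + v.1 * R v := by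
  obtain ⟨p, r, hp⟩ := hG
  choose q hqn hq using fun n =>
    ContinuousMultilinearMap.exists_apply_sub_apply_eq_fst_smul n (p (n + 1))
  obtain ⟨C, a, hC, ha, hpn⟩ := p.le_mul_pow_of_radius_pos (hp.r_pos.trans_le hp.r_le)
  let Q : FormalMultilinearSeries ℂ (ℂ × ℂ) ℂ := q
  have hQ : 0 < Q.radius := by
    -- The factor `n + 1 ≤ 2 ^ n` from the division costs at most half of the radius `a⁻¹`.
    have hs : 0 < (2 * a)⁻¹ := by positivity
    refine lt_of_lt_of_le ?_
      (Q.le_radius_of_bound (C * a) (r := ⟨(2 * a)⁻¹, hs.le⟩) fun n => ?_)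
    · exact ENNReal.coe_pos.2 hs
    · have h2 : ((n : ℝ) + 1) ≤ 2 ^ n := by exact_mod_cast Nat.lt_two_pow_self (n := n)
      calc ‖q n‖ * ((2 * a)⁻¹) ^ n ≤ (2 ^ n * (C * a ^ (n + 1))) * ((2 * a)⁻¹) ^ n := by
            gcongr
            exact (hqn n).trans (by gcongr; exact hpn (n + 1))
        _ = C * a := by
            rw [inv_pow, mul_pow, pow_succ]
            field_simp
  have hQs := Q.hasFPowerSeriesOnBall hQ
  refine ⟨Q.sum, hQs.analyticAt, ?_⟩
  have hsnd : Tendsto (fun v : ℂ × ℂ => ((0 : ℂ), v.2)) (𝓝 0) (𝓝 0) := by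
    have : Continuous fun v : ℂ × ℂ => ((0 : ℂ), v.2) := by fun_prop
    exact this.tendsto' 0 0 rfl
  have hb := Metric.eball_mem_nhds (0 : ℂ × ℂ) hp.r_pos
  filter_upwards [hb, hsnd hb, Metric.eball_mem_nhds (0 : ℂ × ℂ) hQ] with v hv hv' hvQ
  have h1 := hp.hasSum hv
  have h2 := hp.hasSum hv'
  have h3 := (hQs.hasSum hvQ).mul_left v.1
  rw [zero_add] at h1 h2 h3
  have h4 := (hasSum_nat_add_iff' 1).2 (h1.sub h2)
  have h5 : (fun n => p (n + 1) (fun _ => v) - p (n + 1) fun _ => (0, v.2))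
      = fun n => v.1 * Q n fun _ => v := by
    funext n
    exact hq n v
  have h0 : (p 0 fun _ => v) = p 0 fun _ => (0, v.2) := by
    congr 1
    exact Subsingleton.elim _ _
  simp only [Finset.range_one, Finset.sum_singleton, h0, sub_self, sub_zero] at h4
  rw [h5] at h4
  linear_combination h4.unique h3

attribute [fun_prop] analyticAt_fst analyticAt_snd

/-- Iterated division by `x`. The coefficients `b i` do not depend on the truncation `K`; only the
remainder and the neighbourhood do. -/
theorem AnalyticAt.exists_fst_expansion {G : ℂ × ℂ → ℂ} (hG : AnalyticAt ℂ G 0) :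
    ∃ (b : ℕ → ℂ → ℂ) (R : ℕ → ℂ × ℂ → ℂ), (∀ i, AnalyticAt ℂ (b i) 0) ∧
      (∀ K, AnalyticAt ℂ (R K) 0) ∧ ∀ K, ∀ᶠ v in 𝓝 (0 : ℂ × ℂ),
        G v = ∑ i ∈ Finset.range K, b i v.2 * v.1 ^ i + v.1 ^ K * R K v := by
  choose! D hD hDeq using fun (H : ℂ × ℂ → ℂ) (hH : AnalyticAt ℂ H 0) => hH.exists_eq_add_fst_mul
  let R : ℕ → ℂ × ℂ → ℂ := fun K => D^[K] G
  have hR (K : ℕ) : AnalyticAt ℂ (R K) 0 := by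
    induction K with
    | zero => exact hG
    | succ K ih =>
      simp only [R, Function.iterate_succ_apply']
      exact hD _ ih
  refine ⟨fun i t => R i (0, t), R, fun i => ?_, hR, fun K => ?_⟩
  · exact AnalyticAt.fun_comp (f := fun t : ℂ => ((0 : ℂ), t)) (x := 0) (hR i) (by fun_prop)
  · induction K with
    | zero => simp [R]
    | succ K ih =>
      filter_upwards [ih, hDeq _ (hR K)] with v hv hv'
      rw [hv, hv', Finset.sum_range_succ, pow_succ]
      simp only [R, Function.iterate_succ_apply']
      ring

/-- A first nonzero homogeneous term, of degree `k`, would have to be `O(‖v‖ ^ (k + 1))`. -/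
theorem HasFPowerSeriesAt.eventually_eq_zero_of_forall_isBigO {G : ℂ × ℂ → ℂ}
    {p : FormalMultilinearSeries ℂ (ℂ × ℂ) ℂ} (hp : HasFPowerSeriesAt G p 0)
    (h : ∀ n : ℕ, G =O[𝓝 0] fun v => ‖v‖ ^ n) : ∀ᶠ v in 𝓝 0, G v = 0 := by
  have hzero (n : ℕ) : ∀ y, (p n fun _ => y) = 0 := by
    refine Nat.strong_induction_on n fun k hk => ?_
    have psum_eq : p.partialSum (k + 1) = fun y => p k fun _ => y := by
      funext z
      refine Finset.sum_eq_single _ (fun b hb hnb => ?_) fun hn => ?_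
      · exact hk b ((Finset.mem_range_succ_iff.mp hb).lt_of_ne hnb) z
      · exact (hn (Finset.mem_range.mpr k.lt_succ_self)).elim
    have h1 := hp.isBigO_sub_partialSum_pow (k + 1)
    simp only [psum_eq, zero_add] at h1
    have h2 := (h (k + 1)).sub h1
    simp only [sub_sub_cancel] at h2
    exact h2.continuousMultilinearMap_apply_eq_zero
  filter_upwards [hp.eventually_hasSum] with v hv
  simp only [hzero, zero_add] at hv
  exact hv.unique hasSum_zero

theorem AnalyticAt.eventually_eq_zero_of_fst_expansion {G : ℂ × ℂ → ℂ} (hG : AnalyticAt ℂ G 0)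
    {b : ℕ → ℂ → ℂ} {R : ℕ → ℂ × ℂ → ℂ} (hR : ∀ K, AnalyticAt ℂ (R K) 0)
    (h : ∀ K, ∀ᶠ v in 𝓝 (0 : ℂ × ℂ),
      G v = ∑ i ∈ Finset.range K, b i v.2 * v.1 ^ i + v.1 ^ K * R K v)
    (hb : ∀ i, ∀ᶠ t in 𝓝 0, b i t = 0) : ∀ᶠ v in 𝓝 0, G v = 0 := by
  obtain ⟨p, hp⟩ := hG
  refine hp.eventually_eq_zero_of_forall_isBigO fun n => ?_
  have h1 : G =ᶠ[𝓝 0] fun v => v.1 ^ n * R n v := by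
    have h2 : ∀ᶠ v in 𝓝 (0 : ℂ × ℂ), ∀ i ∈ Finset.range n, b i v.2 = 0 := by
      rw [Finset.eventually_all]
      exact fun i _ => (continuous_snd.tendsto' (0 : ℂ × ℂ) 0 rfl).eventually (hb i)
    filter_upwards [h n, h2] with v hv hv2
    rw [hv, Finset.sum_eq_zero fun i hi => by rw [hv2 i hi, zero_mul], zero_add]
  refine h1.trans_isBigO ?_
  have h3 : (fun v : ℂ × ℂ => v.1 ^ n) =O[𝓝 0] fun v => ‖v‖ ^ n :=
    Asymptotics.IsBigO.of_bound 1 <| .of_forall fun v => by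
      simpa using pow_le_pow_left₀ (norm_nonneg _) (norm_fst_le v) n
  simpa using h3.mul ((hR n).continuousAt.isBigO_one ℝ)

/-! ### Derivatives in `x` and the implicit function theorem -/

theorem iteratedDeriv_zero_of_eventually_eq_sum {g r : ℂ → ℂ} {c : ℕ → ℂ} {k : ℕ}
    (hr : AnalyticAt ℂ r 0)
    (h : ∀ᶠ z in 𝓝 0, g z = ∑ i ∈ Finset.range (k + 1), c i * z ^ i + z ^ (k + 1) * r z) :
    iteratedDeriv k g 0 = k.factorial * c k := by
  have h1 : AnalyticAt ℂ (fun z => ∑ i ∈ Finset.range (k + 1), c i * z ^ i) 0 :=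
    Finset.analyticAt_fun_sum _ fun i _ => by fun_prop
  have h2 : AnalyticAt ℂ (fun z => z ^ (k + 1) * r z) 0 := by fun_prop
  have h3 : iteratedDeriv k (fun z => z ^ (k + 1) * r z) 0 = 0 := by
    refine (natCast_le_analyticOrderAt_iff_iteratedDeriv_eq_zero (n := k + 1) h2).1 ?_ k
      k.lt_succ_self
    exact (natCast_le_analyticOrderAt h2).2 ⟨r, hr, by simp⟩
  rw [(show g =ᶠ[𝓝 0] _ from h).iteratedDeriv_eq,
    iteratedDeriv_fun_add h1.contDiffAt h2.contDiffAt, h3, add_zero]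
  simp (disch := fun_prop) only [iteratedDeriv_fun_sum, iteratedDeriv_const_mul_field,
      iteratedDeriv_fun_pow_zero]
  simp [mul_comm]

theorem AnalyticAt.partialX {G : ℂ × ℂ → ℂ} {v : ℂ × ℂ} (hG : AnalyticAt ℂ G v) :
    AnalyticAt ℂ (partialX G) v := by
  have h : AnalyticAt ℂ (fun u => fderiv ℂ G u (1, 0)) v :=
    ((ContinuousLinearMap.apply ℂ ℂ ((1, 0) : ℂ × ℂ)).analyticAt _).comp hG.fderiv
  refine h.congr ?_
  filter_upwards [hG.eventually_analyticAt] with u hu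
  have h1 : HasDerivAt (fun x : ℂ => (x, u.2)) ((1 : ℂ), (0 : ℂ)) u.1 :=
    (hasDerivAt_id _).prodMk (hasDerivAt_const _ _)
  exact (hu.differentiableAt.hasFDerivAt.comp_hasDerivAt u.1 h1).deriv.symm

theorem partialX_iterate_apply (G : ℂ × ℂ → ℂ) (k : ℕ) (v : ℂ × ℂ) :
    partialX^[k] G v = iteratedDeriv k (fun z => G (z, v.2)) v.1 := by
  induction k generalizing v with
  | zero => simp
  | succ k ih =>
    rw [Function.iterate_succ_apply', iteratedDeriv_succ]
    simp only [partialX, ih]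

theorem AnalyticAt.partialX_iterate {G : ℂ × ℂ → ℂ} {v : ℂ × ℂ} (hG : AnalyticAt ℂ G v) (k : ℕ) :
    AnalyticAt ℂ (_root_.partialX^[k] G) v := by
  induction k with
  | zero => exact hG
  | succ k ih =>
    rw [Function.iterate_succ_apply']
    exact ih.partialX

/-- The analytic implicit function theorem, solving for the first coordinate. -/
theorem AnalyticAt.exists_implicit {D : ℂ × ℂ → ℂ} (hD : AnalyticAt ℂ D 0) (h0 : D 0 = 0)
    (h1 : deriv (fun z => D (z, 0)) 0 ≠ 0) :
    ∃ φ : ℂ → ℂ, AnalyticAt ℂ φ 0 ∧ φ 0 = 0 ∧ ∀ᶠ t in 𝓝 0, D (φ t, t) = 0 := by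
  -- The coordinates are swapped because `implicitFunction` solves for the second one.
  let S : ℂ × ℂ → ℂ := fun v => D (v.2, v.1)
  have hS : AnalyticAt ℂ S ((0 : ℂ), (0 : ℂ)) :=
    AnalyticAt.fun_comp (f := fun v : ℂ × ℂ => (v.2, v.1)) (g := D) (x := ((0 : ℂ), (0 : ℂ))) hD
      (by fun_prop)
  have hc : ContDiffAt ℂ ⊤ S ((0 : ℂ), (0 : ℂ)) := hS.contDiffAt
  have hinv : (fderiv ℂ S ((0 : ℂ), (0 : ℂ)) ∘L .inr ℂ ℂ ℂ).IsInvertible := by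
    have h2 : HasDerivAt (fun x : ℂ => ((0 : ℂ), x)) ((0 : ℂ), (1 : ℂ)) 0 :=
      (hasDerivAt_const _ _).prodMk (hasDerivAt_id _)
    have h3 := (HasFDerivAt.comp_hasDerivAt (x := (0 : ℂ)) (f := fun x : ℂ => ((0 : ℂ), x))
      hS.differentiableAt.hasFDerivAt h2).deriv
    have h4 : fderiv ℂ S ((0 : ℂ), (0 : ℂ)) (0, 1) ≠ 0 := by
      rw [← h3]
      exact h1
    refine ⟨ContinuousLinearEquiv.unitsEquivAut ℂ (Units.mk0 _ h4), ?_⟩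
    ext
    simp
  refine ⟨hc.implicitFunction (by simp) hinv, ?_, ?_, ?_⟩
  · exact (hc.contDiffAt_implicitFunction (by simp) hinv).analyticAt
  · exact hc.implicitFunction_apply_self (by simp) hinv
  · filter_upwards [hc.eventually_apply_implicitFunction (by simp) hinv] with t ht
    exact ht.trans h0

/-! ### Newton polygons and the existence of Puiseux branches -/

/-- Under `x = w s^p`, `y = s^q` the term `b(y) x^i` has order `p i + q ord b` in `s`. It survives
division by `s^e` at `s = 0` exactly when the point `(i, ord b)` lies on the line of weight `e`. -/
theorem AnalyticAt.exists_comp_pow_mul_pow_eq {b : ℂ → ℂ} (hb : AnalyticAt ℂ b 0) {p q e : ℕ}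
    (hq : 0 < q) (i : ℕ) (he : (e : ℕ∞) ≤ p * i + q * analyticOrderAt b 0) :
    ∃ β : ℂ → ℂ, AnalyticAt ℂ β 0 ∧
      (∀ᶠ s in 𝓝 0, b (s ^ q) * s ^ (p * i) = s ^ e * β s) ∧
      (β 0 ≠ 0 ↔ (e : ℕ∞) = p * i + q * analyticOrderAt b 0) := by
  have hs : Tendsto (fun s : ℂ => s ^ q) (𝓝 0) (𝓝 0) :=
    (continuous_pow q).tendsto' _ _ (zero_pow hq.ne')
  by_cases htop : analyticOrderAt b 0 = ⊤
  · refine ⟨0, analyticAt_const, ?_, ?_⟩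
    · filter_upwards [hs.eventually (analyticOrderAt_eq_top.1 htop)] with s h
      simp [h]
    · rw [htop, ENat.mul_top (by exact_mod_cast hq.ne')]
      simp
  · obtain ⟨m, hm⟩ := ENat.ne_top_iff_exists.1 htop
    obtain ⟨u, hu, hu0, hbu⟩ := hb.analyticOrderAt_eq_natCast.1 hm.symm
    rw [← hm] at he ⊢
    norm_cast at he ⊢
    refine ⟨fun s => s ^ (p * i + q * m - e) * u (s ^ q), ?_, ?_, ?_⟩
    · have h1 : AnalyticAt ℂ (fun s : ℂ => u (s ^ q)) 0 :=
        AnalyticAt.fun_comp (f := fun s : ℂ => s ^ q) (by rwa [zero_pow hq.ne']) (by fun_prop)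
      exact AnalyticAt.fun_mul (by fun_prop) h1
    · filter_upwards [hs.eventually hbu] with s h
      rw [h, ← mul_assoc, ← pow_add, Nat.add_sub_cancel' he, sub_zero, smul_eq_mul, ← pow_mul,
        pow_add]
      ring
    · simp only [zero_pow hq.ne', ne_eq, mul_eq_zero, hu0, or_false, pow_eq_zero_iff', true_and]
      omega

/-- Dividing out the weighted order of a germ along the substitution `(w s ^ p, s ^ q)`. -/
theorem exists_weighted_quotient {G : ℂ × ℂ → ℂ} {b : ℕ → ℂ → ℂ} {R : ℂ × ℂ → ℂ} {K : ℕ}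
    (hR : AnalyticAt ℂ R 0)
    (h : ∀ᶠ v in 𝓝 (0 : ℂ × ℂ), G v = ∑ i ∈ Finset.range K, b i v.2 * v.1 ^ i + v.1 ^ K * R v)
    {p q e : ℕ} (hp : 0 < p) (hq : 0 < q) (he : e < p * K) {β : ℕ → ℂ → ℂ}
    (hβ : ∀ i, AnalyticAt ℂ (β i) 0)
    (hbβ : ∀ i < K, ∀ᶠ s in 𝓝 0, b i (s ^ q) * s ^ (p * i) = s ^ e * β i s) :
    ∃ G₁ : ℂ × ℂ → ℂ, (∀ w, AnalyticAt ℂ G₁ (w, 0)) ∧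
      (∀ w, G₁ (w, 0) = ∑ i ∈ Finset.range K, β i 0 * w ^ i) ∧
      ∀ w, ∀ᶠ v in 𝓝 (w, 0), G (v.1 * v.2 ^ p, v.2 ^ q) = v.2 ^ e * G₁ v := by
  have hsub (w : ℂ) : Tendsto (fun v : ℂ × ℂ => (v.1 * v.2 ^ p, v.2 ^ q)) (𝓝 (w, 0)) (𝓝 0) := by
    refine Continuous.tendsto' (by fun_prop) _ _ ?_
    simp [hp.ne', hq.ne']
  have hsnd (w : ℂ) : Tendsto (Prod.snd : ℂ × ℂ → ℂ) (𝓝 (w, 0)) (𝓝 0) :=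
    continuous_snd.tendsto' _ _ rfl
  -- By `e < p * K` the remainder keeps a positive power of `s`, so it does not contribute at `s =
  -- 0`.
  refine ⟨fun v => ∑ i ∈ Finset.range K, β i v.2 * v.1 ^ i +
    v.2 ^ (p * K - e) * (v.1 ^ K * R (v.1 * v.2 ^ p, v.2 ^ q)), fun w => ?_, fun w => ?_,
    fun w => ?_⟩
  · have h1 : AnalyticAt ℂ (fun v : ℂ × ℂ => R (v.1 * v.2 ^ p, v.2 ^ q)) (w, 0) := by
      refine AnalyticAt.fun_comp (f := fun v : ℂ × ℂ => (v.1 * v.2 ^ p, v.2 ^ q)) ?_ (by fun_prop)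
      simpa [hp.ne', hq.ne', Prod.zero_eq_mk] using hR
    have h2 (i : ℕ) : AnalyticAt ℂ (fun v : ℂ × ℂ => β i v.2) (w, 0) :=
      AnalyticAt.fun_comp (f := fun v : ℂ × ℂ => v.2) (x := (w, 0)) (hβ i) (by fun_prop)
    have h3 : AnalyticAt ℂ (fun v : ℂ × ℂ => ∑ i ∈ Finset.range K, β i v.2 * v.1 ^ i) (w, 0) :=
      Finset.analyticAt_fun_sum _ fun i _ => (h2 i).fun_mul (by fun_prop)
    exact h3.fun_add (AnalyticAt.fun_mul (by fun_prop) (AnalyticAt.fun_mul (by fun_prop) h1))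
  · simp [Nat.sub_ne_zero_of_lt he]
  · have h2 : ∀ᶠ v in 𝓝 (w, (0 : ℂ)), ∀ i ∈ Finset.range K,
        b i (v.2 ^ q) * v.2 ^ (p * i) = v.2 ^ e * β i v.2 := by
      rw [Finset.eventually_all]
      exact fun i hi => (hsnd w).eventually (hbβ i (Finset.mem_range.1 hi))
    filter_upwards [(hsub w).eventually h, h2] with v hv hv2
    rw [hv, mul_add, Finset.mul_sum, ← mul_assoc (v.2 ^ e), ← pow_add, Nat.add_sub_cancel' he.le]
    congr 1
    · refine Finset.sum_congr rfl fun i hi => ?_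
      rw [mul_pow, ← pow_mul]
      linear_combination v.1 ^ i * hv2 i hi
    · rw [mul_pow, ← pow_mul]
      ring

theorem eventually_iteratedDeriv_fst_eq {G : ℂ × ℂ → ℂ} {b : ℕ → ℂ → ℂ} {R : ℂ × ℂ → ℂ} {k : ℕ}
    (hR : AnalyticAt ℂ R 0)
    (h : ∀ᶠ v in 𝓝 (0 : ℂ × ℂ),
      G v = ∑ i ∈ Finset.range (k + 1), b i v.2 * v.1 ^ i + v.1 ^ (k + 1) * R v) :
    ∀ᶠ t in 𝓝 0, iteratedDeriv k (fun z => G (z, t)) 0 = k.factorial * b k t := by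
  have h1 : Tendsto (fun t : ℂ => ((0 : ℂ), t)) (𝓝 0) (𝓝 0) :=
    Continuous.tendsto' (by fun_prop) _ _ rfl
  filter_upwards [h1.eventually h.eventually_nhds, h1.eventually hR.eventually_analyticAt]
    with t ht hRt
  refine iteratedDeriv_zero_of_eventually_eq_sum (c := fun i => b i t) (r := fun z => R (z, t))
    (AnalyticAt.fun_comp (f := fun z : ℂ => (z, t)) (x := 0) hRt (by fun_prop)) ?_
  have h2 : Tendsto (fun z : ℂ => (z, t)) (𝓝 0) (𝓝 (0, t)) :=
    Continuous.tendsto' (by fun_prop) _ _ rfl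
  exact h2.eventually ht

theorem Polynomial.analyticOrderAt_eval_add {P : Polynomial ℂ} (hP : P ≠ 0) (w : ℂ) :
    analyticOrderAt (fun z => P.eval (w + z)) 0 = P.rootMultiplicity w := by
  have han (Q : Polynomial ℂ) : AnalyticAt ℂ (fun z => Q.eval (w + z)) 0 :=
    AnalyticAt.fun_comp (g := fun x => Q.eval x) (f := fun z => w + z)
      (AnalyticOnNhd.eval_polynomial Q _ (Set.mem_univ _)) (by fun_prop)
  rw [(han P).analyticOrderAt_eq_natCast]
  obtain ⟨Q, hQ, hQw⟩ := P.exists_eq_pow_rootMultiplicity_mul_and_not_dvd hP w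
  refine ⟨fun z => Q.eval (w + z), han Q, ?_, .of_forall fun z => ?_⟩
  · simpa [Polynomial.dvd_iff_isRoot] using hQw
  · conv_lhs => rw [hQ]
    simp

/-- A root `w` of multiplicity `d` would give `P = c (X - w)^d`. The missing term of degree `d - 1`
then forces `w = 0`, and `P = c X^d` has no other term. -/
theorem Polynomial.exists_isRoot_rootMultiplicity_lt {P : Polynomial ℂ} {d i : ℕ}
    (hd : P.natDegree = d) (h1 : P.coeff (d - 1) = 0) (hi : i < d) (hPi : P.coeff i ≠ 0) :
    ∃ w, P.IsRoot w ∧ P.rootMultiplicity w < d := by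
  have hP : P ≠ 0 := fun h => hPi (by simp [h])
  obtain ⟨w, hw⟩ := IsAlgClosed.exists_root P (by
    rw [Polynomial.degree_eq_natDegree hP, hd]
    exact_mod_cast (by omega : d ≠ 0))
  refine ⟨w, hw, lt_of_le_of_ne ?_ fun h => ?_⟩
  · rw [← Polynomial.count_roots, ← hd]
    exact (Multiset.count_le_card _ _).trans (Polynomial.card_roots' P)
  obtain ⟨Q, hQ⟩ := P.pow_rootMultiplicity_dvd w
  rw [h] at hQ
  have hQ0 : Q ≠ 0 := by
    rintro rfl
    exact hP (by simpa using hQ)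
  have hdeg := congrArg Polynomial.natDegree hQ
  rw [Polynomial.natDegree_mul (pow_ne_zero _ (Polynomial.X_sub_C_ne_zero w)) hQ0,
    Polynomial.natDegree_pow, Polynomial.natDegree_X_sub_C, hd] at hdeg
  obtain ⟨c, rfl⟩ := Polynomial.natDegree_eq_zero.1 (by omega : Q.natDegree = 0)
  have hc : c ≠ 0 := by simpa using hQ0
  have hw0 : w = 0 := by
    rw [hQ, Polynomial.coeff_mul_C, sub_eq_add_neg, ← Polynomial.C_neg,
      Polynomial.coeff_X_add_C_pow, Nat.sub_sub_self (by omega : 1 ≤ d)] at h1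
    have : d.choose (d - 1) ≠ 0 := (Nat.choose_pos (by omega)).ne'
    simpa [hc, this] using h1
  rw [hQ, Polynomial.coeff_mul_C, sub_eq_add_neg, ← Polynomial.C_neg, Polynomial.coeff_X_add_C_pow,
    hw0] at hPi
  exact hPi (by simp [Nat.sub_ne_zero_of_lt hi])

/-- Every germ `G` with `G (0, 0) = 0` and `G (z, 0) ≢ 0` vanishes along a Puiseux arc. -/
theorem AnalyticAt.exists_puiseux_branch (d : ℕ) {G : ℂ × ℂ → ℂ} (hG : AnalyticAt ℂ G 0)
    (hd : analyticOrderAt (fun z => G (z, 0)) 0 = d) (hd0 : 0 < d) :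
    ∃ M : ℕ, 0 < M ∧ ∃ ζ : ℂ → ℂ, AnalyticAt ℂ ζ 0 ∧ ζ 0 = 0 ∧
      ∀ᶠ u in 𝓝 0, G (ζ u, u ^ M) = 0 := by
  induction d using Nat.strong_induction_on generalizing G with
  | _ d ih =>
  have hG0 : AnalyticAt ℂ (fun z => G (z, 0)) 0 :=
    AnalyticAt.fun_comp (f := fun z : ℂ => (z, (0 : ℂ))) (x := 0) hG (by fun_prop)
  obtain ⟨hlt, hne⟩ := (analyticOrderAt_eq_nat_iff_iteratedDeriv_eq_zero hG0).1 hd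
  -- Tschirnhausen shift: along `x = φ(y)` the derivative of order `d - 1` vanishes, so translating
  -- by `φ` kills the coefficient of `x^(d-1)`.
  obtain ⟨φ, hφ, hφ0, hDφ⟩ := (hG.partialX_iterate (d - 1)).exists_implicit
    (by simpa [partialX_iterate_apply] using hlt (d - 1) (by omega))
    (by
      simp only [partialX_iterate_apply]
      rwa [← iteratedDeriv_succ, Nat.sub_add_cancel hd0])
  simp only [partialX_iterate_apply] at hDφ
  set G₂ : ℂ × ℂ → ℂ := fun v => G (v.1 + φ v.2, v.2) with hG₂def
  have hφ2 : AnalyticAt ℂ (fun v : ℂ × ℂ => φ v.2) 0 :=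
    AnalyticAt.fun_comp (f := fun v : ℂ × ℂ => v.2) (x := 0) hφ (by fun_prop)
  have hG₂ : AnalyticAt ℂ G₂ 0 :=
    AnalyticAt.fun_comp (f := fun v : ℂ × ℂ => (v.1 + φ v.2, v.2)) (x := 0)
      (by simpa [hφ0, Prod.zero_eq_mk] using hG)
      ((analyticAt_fst.fun_add hφ2).prod analyticAt_snd)
  obtain ⟨b, R, hb, hR, hexp⟩ := hG₂.exists_fst_expansion
  have hder (k : ℕ) := eventually_iteratedDeriv_fst_eq (hR (k + 1)) (hexp (k + 1))
  have hfac (k : ℕ) : (k.factorial : ℂ) ≠ 0 := by exact_mod_cast k.factorial_ne_zero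
  have hb_lt (k : ℕ) (hk : k < d) : b k 0 = 0 := by
    have := (hder k).self_of_nhds
    simp only [hG₂def, hφ0, add_zero] at this
    rw [hlt k hk] at this
    simpa [hfac] using this.symm
  have hb_d : b d 0 ≠ 0 := by
    have := (hder d).self_of_nhds
    simp only [hG₂def, hφ0, add_zero] at this
    intro h0
    exact hne (by rw [this, h0, mul_zero])
  have hb_pred : analyticOrderAt (b (d - 1)) 0 = ⊤ := by
    rw [analyticOrderAt_eq_top]
    filter_upwards [hder (d - 1), hDφ] with t ht ht2
    simp only [hG₂def] at ht
    rw [iteratedDeriv_comp_add_const (d - 1) (fun z => G (z, t))] at ht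
    simp only [zero_add] at ht
    rw [ht2] at ht
    simpa [hfac] using ht.symm
  -- Here `x = φ(y)` is itself a branch. This case contains `d = 1`, where `b (d - 1)` is `b 0`.
  by_cases htop : analyticOrderAt (b 0) 0 = ⊤
  · refine ⟨1, one_pos, φ, hφ, hφ0, ?_⟩
    have h1 : Tendsto (fun t : ℂ => ((0 : ℂ), t)) (𝓝 0) (𝓝 0) :=
      Continuous.tendsto' (by fun_prop) _ _ rfl
    filter_upwards [h1.eventually (hexp 1), analyticOrderAt_eq_top.1 htop] with t ht ht2
    simpa [hG₂def, ht2] using ht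
  set m : ℕ → ℕ := fun i => analyticOrderNatAt (b i) 0 with hm
  have hcast {i : ℕ} (hi : analyticOrderAt (b i) 0 ≠ ⊤) : (m i : ℕ∞) = analyticOrderAt (b i) 0 :=
    Nat.cast_analyticOrderNatAt hi
  -- The minimal slope selects the edge of the Newton polygon that ends at `(d, 0)`. The weights `p
  -- = m j`, `q = d - j` need not be coprime; the edge has weight `m j * d`.
  obtain ⟨j, hjS, hjmin⟩ := Finset.exists_min_image
    ((Finset.range d).filter fun i => analyticOrderAt (b i) 0 ≠ ⊤)
    (fun i => (m i : ℚ) / ((d - i : ℕ) : ℚ)) ⟨0, by simp [hd0, htop]⟩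
  simp only [Finset.mem_filter, Finset.mem_range] at hjS hjmin
  obtain ⟨hjd, hjtop⟩ := hjS
  have hp : 0 < m j := by
    have h1 := (hb j).analyticOrderAt_ne_zero.2 (hb_lt j hjd)
    rw [← hcast hjtop] at h1
    exact Nat.pos_of_ne_zero (by exact_mod_cast h1)
  have hq : 0 < d - j := by omega
  have hle (i : ℕ) : ((m j * d : ℕ) : ℕ∞) ≤
      (m j : ℕ) * i + (d - j : ℕ) * analyticOrderAt (b i) 0 := by
    by_cases hitop : analyticOrderAt (b i) 0 = ⊤
    · rw [hitop, ENat.mul_top (by exact_mod_cast hq.ne')]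
      simp
    rw [← hcast hitop]
    norm_cast
    rcases le_or_gt d i with hi | hi
    · exact (Nat.mul_le_mul_left _ hi).trans (Nat.le_add_right _ _)
    · have h1 := hjmin i ⟨hi, hitop⟩
      rw [div_le_div_iff₀ (by exact_mod_cast hq) (by exact_mod_cast Nat.sub_pos_of_lt hi)] at h1
      have h2 : m j * (d - i) ≤ m i * (d - j) := by exact_mod_cast h1
      calc m j * d = m j * i + m j * (d - i) := by rw [← mul_add, Nat.add_sub_cancel' hi.le]
        _ ≤ _ := by rw [mul_comm (d - j)]; omega
  choose β hβ hbβ hβ0 using fun i => (hb i).exists_comp_pow_mul_pow_eq hq i (hle i)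
  obtain ⟨G₁, hG₁, hG₁0, hG₁eq⟩ := exists_weighted_quotient (hR (d + 1)) (hexp (d + 1)) hp hq
    (Nat.mul_lt_mul_of_pos_left d.lt_succ_self hp) hβ fun i _ => hbβ i
  let P : Polynomial ℂ := ∑ i ∈ Finset.range (d + 1), Polynomial.monomial i (β i 0)
  have hcoeff (i : ℕ) : P.coeff i = if i < d + 1 then β i 0 else 0 := by
    simp [P, Polynomial.coeff_monomial]
  have heval (w : ℂ) : G₁ (w, 0) = P.eval w := by
    simp [P, hG₁0, Polynomial.eval_finsetSum]
  have hβd : β d 0 ≠ 0 := by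
    rw [hβ0, (hb d).analyticOrderAt_eq_zero.2 hb_d]
    simp
  have hPd : P.natDegree = d := by
    refine Polynomial.natDegree_eq_of_le_of_coeff_ne_zero ?_ (by simpa [hcoeff] using hβd)
    refine Polynomial.natDegree_le_iff_coeff_eq_zero.2 fun i hi => ?_
    simp [hcoeff, Nat.not_lt.2 (Nat.succ_le_of_lt hi)]
  have hPpred : P.coeff (d - 1) = 0 := by
    rw [hcoeff, if_pos (by omega)]
    by_contra h
    rw [← ne_eq, hβ0, hb_pred, ENat.mul_top (by exact_mod_cast hq.ne')] at h
    exact ENat.natCast_ne_top (m j * d) (by simpa using h)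
  have hPj : P.coeff j ≠ 0 := by
    rw [hcoeff, if_pos (by omega), hβ0, ← hcast hjtop]
    norm_cast
    rw [mul_comm (d - j), ← mul_add, Nat.add_sub_cancel' hjd.le]
  obtain ⟨w, hw, hwd⟩ := Polynomial.exists_isRoot_rootMultiplicity_lt hPd hPpred hjd hPj
  have hP : P ≠ 0 := fun h => hPj (by simp [h])
  obtain ⟨M, hM, ζ, hζ, hζ0, hGζ⟩ := ih _ hwd (G := fun v => G₁ (w + v.1, v.2))
    (AnalyticAt.fun_comp (f := fun v : ℂ × ℂ => (w + v.1, v.2)) (x := 0)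
      (by simpa using hG₁ w) (by fun_prop))
    (by simpa only [heval] using Polynomial.analyticOrderAt_eval_add hP w)
    ((Polynomial.rootMultiplicity_pos hP).2 hw)
  have hMq : M * (d - j) ≠ 0 := (Nat.mul_pos hM hq).ne'
  -- Undoing the substitutions with `s = u^M`: `y = s^q` and `x = (w + ζ u) s^p + φ(y)`.
  refine ⟨M * (d - j), Nat.pos_of_ne_zero hMq,
    fun u => (w + ζ u) * u ^ (M * m j) + φ (u ^ (M * (d - j))), ?_, ?_, ?_⟩
  · have h1 : AnalyticAt ℂ (fun u : ℂ => φ (u ^ (M * (d - j)))) 0 :=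
      AnalyticAt.fun_comp (f := fun u : ℂ => u ^ (M * (d - j))) (by rwa [zero_pow hMq])
        (by fun_prop)
    exact AnalyticAt.fun_add (by fun_prop) h1
  · simp [hMq, hφ0, hM.ne', hp.ne']
  · have h1 : Tendsto (fun u : ℂ => (w + ζ u, u ^ M)) (𝓝 0) (𝓝 (w, 0)) := by
      have h2 : ContinuousAt (fun u : ℂ => (w + ζ u, u ^ M)) 0 := by
        have := hζ.continuousAt
        fun_prop
      simpa [ContinuousAt, hζ0, hM.ne'] using h2
    filter_upwards [h1.eventually (hG₁eq w), hGζ] with u hu hu2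
    simp only [← pow_mul, hG₂def] at hu
    rw [hu, hu2, mul_zero]

/-- Passing to `P'` lowers the multiplicity of each root of `P` by one. If all critical points were
roots, `P'` would have at most `deg P - 2` roots with multiplicity, instead of `deg P - 1`. -/
theorem Polynomial.exists_isRoot_derivative_not_isRoot {P : Polynomial ℂ} (hP : P ≠ 0) {a b : ℂ}
    (ha : P.IsRoot a) (hb : P.IsRoot b) (hab : a ≠ b) :
    ∃ z, P.derivative.IsRoot z ∧ ¬ P.IsRoot z := by
  by_contra! h
  have hdeg : 0 < P.natDegree := by
    refine Nat.pos_of_ne_zero fun h0 => ?_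
    obtain ⟨c, rfl⟩ := Polynomial.natDegree_eq_zero.1 h0
    exact hP (by simpa using ha)
  have hcard (Q : Polynomial ℂ) : Q.roots.card = Q.natDegree := IsAlgClosed.card_roots_eq_natDegree
  have hP' : P.derivative ≠ 0 := fun h0 =>
    hdeg.ne' (Polynomial.derivative_eq_zero.1 h0)
  have hle : P.derivative.roots ≤ P.roots - P.roots.dedup := by
    rw [Multiset.le_iff_count]
    intro z
    by_cases hz : P.derivative.IsRoot z
    · have hz2 := h z hz
      rw [Multiset.count_sub, Polynomial.count_roots, Polynomial.count_roots,
        Polynomial.derivative_rootMultiplicity_of_root hz2,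
        Multiset.count_eq_one_of_mem (Multiset.nodup_dedup _)
          (Multiset.mem_dedup.2 ((Polynomial.mem_roots hP).2 hz2))]
    · rw [Polynomial.count_roots, Polynomial.rootMultiplicity_eq_zero hz]
      exact Nat.zero_le _
  have h1 := Multiset.card_le_card hle
  have h2 : 1 < P.roots.dedup.card := by
    change 1 < P.roots.toFinset.card
    rw [Finset.one_lt_card]
    exact ⟨a, by simpa [hP] using ha, b, by simpa [hP] using hb, hab⟩
  rw [Multiset.card_sub (Multiset.dedup_le _), hcard, hcard, Polynomial.natDegree_derivative] at h1
  have h3 := (Multiset.card_le_card (Multiset.dedup_le P.roots)).trans_eq (hcard P)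
  omega

/-! ### Puiseux series and their parametrizations -/

theorem isPuiseuxParam_iff {φ : HahnSeries ℚ ℂ} {N : ℕ} {a : ℂ → ℂ} :
    IsPuiseuxParam φ N a ↔ 0 < N ∧ φ.support ⊆ Set.range (fun n : ℕ => (n : ℚ) / (N : ℚ)) ∧
      ∀ᶠ t in 𝓝 (0 : ℂ), HasSum (fun n : ℕ => t ^ n * φ.coeff ((n : ℚ) / (N : ℚ))) (a t) := by
  rw [IsPuiseuxParam, hasFPowerSeriesAt_iff]
  simp [FormalMultilinearSeries.coeff_ofScalars]

namespace IsPuiseuxParam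

variable {φ ψ : HahnSeries ℚ ℂ} {N : ℕ} {a b : ℂ → ℂ}

theorem analyticAt (h : IsPuiseuxParam φ N a) : AnalyticAt ℂ a 0 :=
  h.2.2.analyticAt

theorem apply_zero (h : IsPuiseuxParam φ N a) : a 0 = φ.coeff 0 := by
  have := (isPuiseuxParam_iff.1 h).2.2.self_of_nhds
  have h2 := hasSum_single (f := fun n : ℕ => (0 : ℂ) ^ n * φ.coeff ((n : ℚ) / (N : ℚ))) 0
    fun n hn => by simp [hn]
  simpa using this.unique h2

/-- Serves to bring two series to a common denominator. -/
theorem comp_pow (h : IsPuiseuxParam φ N a) {M : ℕ} (hM : 0 < M) :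
    IsPuiseuxParam φ (N * M) fun t => a (t ^ M) := by
  obtain ⟨hN, hs, hsum⟩ := isPuiseuxParam_iff.1 h
  have hNQ : (N : ℚ) ≠ 0 := by exact_mod_cast hN.ne'
  have hMQ : (M : ℚ) ≠ 0 := by exact_mod_cast hM.ne'
  have hq (n : ℕ) : ((M * n : ℕ) : ℚ) / ((N * M : ℕ) : ℚ) = n / N := by
    push_cast
    field_simp
  refine isPuiseuxParam_iff.2 ⟨Nat.mul_pos hN hM, fun q hqs => ?_, ?_⟩
  · obtain ⟨n, rfl⟩ := hs hqs
    exact ⟨M * n, hq n⟩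
  · have ht : Tendsto (fun t : ℂ => t ^ M) (𝓝 0) (𝓝 0) :=
      (continuous_pow M).tendsto' _ _ (zero_pow hM.ne')
    filter_upwards [ht.eventually hsum] with t h1
    have hinj : Function.Injective fun n : ℕ => M * n :=
      fun x y hxy => Nat.eq_of_mul_eq_mul_left hM hxy
    refine (Function.Injective.hasSum_iff (f := fun n : ℕ =>
      t ^ n * φ.coeff ((n : ℚ) / ((N * M : ℕ) : ℚ))) hinj fun k hk => ?_).1 ?_
    · suffices φ.coeff ((k : ℚ) / ((N * M : ℕ) : ℚ)) = 0 by rw [this, mul_zero]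
      by_contra hne
      obtain ⟨n, hn⟩ := hs hne
      refine hk ⟨n, ?_⟩
      have h2 : (n : ℚ) / N = k / ((N * M : ℕ) : ℚ) := hn
      rw [← hq n, div_left_inj' (by exact_mod_cast (Nat.mul_pos hN hM).ne')] at h2
      exact_mod_cast h2
    · convert h1 using 2 with n
      simp only [Function.comp_apply, hq, pow_mul]

theorem add (h : IsPuiseuxParam φ N a) (h' : IsPuiseuxParam ψ N b) :
    IsPuiseuxParam (φ + ψ) N fun t => a t + b t := by
  obtain ⟨hN, hs, hsum⟩ := isPuiseuxParam_iff.1 h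
  obtain ⟨-, hs', hsum'⟩ := isPuiseuxParam_iff.1 h'
  refine isPuiseuxParam_iff.2 ⟨hN,
    (HahnSeries.support_add_subset _ _).trans (Set.union_subset hs hs'), ?_⟩
  filter_upwards [hsum, hsum'] with t h1 h2
  simpa [mul_add] using h1.add h2

theorem sub (h : IsPuiseuxParam φ N a) (h' : IsPuiseuxParam ψ N b) :
    IsPuiseuxParam (φ - ψ) N fun t => a t - b t := by
  obtain ⟨hN, hs, hsum⟩ := isPuiseuxParam_iff.1 h
  obtain ⟨-, hs', hsum'⟩ := isPuiseuxParam_iff.1 h'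
  refine isPuiseuxParam_iff.2 ⟨hN,
    (HahnSeries.support_sub_subset _ _).trans (Set.union_subset hs hs'), ?_⟩
  filter_upwards [hsum, hsum'] with t h1 h2
  simpa [mul_sub] using h1.sub h2

theorem truncLT (h : IsPuiseuxParam φ N a) (R : ℕ) :
    IsPuiseuxParam (HahnSeries.truncLT ((R : ℚ) / N) φ) N
      fun t => ∑ n ∈ Finset.range R, t ^ n * φ.coeff ((n : ℚ) / N) := by
  obtain ⟨hN, hs, hsum⟩ := isPuiseuxParam_iff.1 h
  refine isPuiseuxParam_iff.2 ⟨hN, (HahnSeries.support_truncLT_subset _ _).trans hs,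
    .of_forall fun t => ?_⟩
  have hlt (n : ℕ) : (n : ℚ) / N < R / N ↔ n < R := by
    rw [div_lt_div_iff_of_pos_right (by exact_mod_cast hN)]
    exact_mod_cast Iff.rfl
  rw [Finset.sum_congr rfl fun n hn => by
    rw [← HahnSeries.coeff_truncLT_of_lt ((hlt n).2 (Finset.mem_range.1 hn))]]
  refine hasSum_sum_of_ne_finset_zero fun n hn => ?_
  rw [HahnSeries.coeff_truncLT_of_le
    (not_lt.1 fun h0 => hn (Finset.mem_range.2 ((hlt n).1 h0))), mul_zero]

theorem exists_eq_pow_mul (h : IsPuiseuxParam φ N a) {R : ℕ}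
    (hφ : ∀ q : ℚ, q < (R : ℚ) / N → φ.coeff q = 0) :
    ∃ z : ℂ → ℂ, AnalyticAt ℂ z 0 ∧ z 0 = φ.coeff ((R : ℚ) / N) ∧
      ∀ᶠ t in 𝓝 0, a t = t ^ R * z t := by
  obtain ⟨hN, hs, hsum⟩ := isPuiseuxParam_iff.1 h
  have hlt (n : ℕ) (hn : n < R) : φ.coeff ((n : ℚ) / N) = 0 := by
    refine hφ _ ?_
    rw [div_lt_div_iff_of_pos_right (by exact_mod_cast hN)]
    exact_mod_cast hn
  let c : ℕ → ℂ := fun n => φ.coeff (((n + R : ℕ) : ℚ) / N)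
  have hshift : ∀ᶠ t in 𝓝 (0 : ℂ), HasSum (fun n => t ^ (n + R) * c n) (a t) := by
    filter_upwards [hsum] with t ht
    rw [hasSum_nat_add_iff (f := fun n : ℕ => t ^ n * φ.coeff ((n : ℚ) / N)) R]
    rwa [Finset.sum_eq_zero fun n hn => by rw [hlt n (Finset.mem_range.1 hn), mul_zero], add_zero]
  -- The value at `0` must be the leading coefficient, since division by zero would give the wrong
  -- one.
  let z : ℂ → ℂ := fun t => if t = 0 then c 0 else (t ^ R)⁻¹ * a t
  have hz : HasFPowerSeriesAt z (FormalMultilinearSeries.ofScalars ℂ c) 0 := by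
    rw [hasFPowerSeriesAt_iff]
    filter_upwards [hshift] with t ht
    simp only [FormalMultilinearSeries.coeff_ofScalars, smul_eq_mul, zero_add, z]
    split_ifs with h0
    · simpa [h0] using hasSum_single (f := fun n : ℕ => t ^ n * c n) 0 fun n hn => by simp [h0, hn]
    · have h1 : (fun n => t ^ n * c n) = fun n => (t ^ R)⁻¹ * (t ^ (n + R) * c n) := by
        funext n
        rw [pow_add]
        field_simp
      rw [h1]
      exact ht.mul_left _
  refine ⟨z, hz.analyticAt, by simp [z, c], ?_⟩
  filter_upwards [hshift] with t ht
  by_cases h0 : t = 0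
  · subst h0
    have h1 := ht.unique (hasSum_single 0 fun n hn => by simp [hn])
    rw [h1]
    simp [z]
  · simp [z, h0]

end IsPuiseuxParam

theorem AnalyticAt.exists_isPuiseuxParam {w : ℂ → ℂ} (hw : AnalyticAt ℂ w 0) {N : ℕ} (hN : 0 < N)
    (R : ℕ) : ∃ ψ : HahnSeries ℚ ℂ, IsPuiseuxParam ψ N (fun t => t ^ R * w t) ∧
      (∀ q : ℚ, q < (R : ℚ) / N → ψ.coeff q = 0) ∧ ψ.coeff ((R : ℚ) / N) = w 0 := by
  obtain ⟨p, hp⟩ : ∃ p, HasFPowerSeriesAt w p 0 := hw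
  have hNQ : (0 : ℚ) < N := by exact_mod_cast hN
  let ι : ℕ ↪o ℚ := OrderEmbedding.ofStrictMono (fun n : ℕ => (n : ℚ) / N)
    fun m n hmn => (div_lt_div_iff_of_pos_right hNQ).2 (by exact_mod_cast hmn)
  let c : ℕ → ℂ := fun n => if n < R then 0 else p.coeff (n - R)
  let χ : HahnSeries ℕ ℂ := HahnSeries.toPowerSeries.symm (PowerSeries.mk c)
  let ψ := HahnSeries.embDomain ι χ
  have hcoeff (n : ℕ) : ψ.coeff ((n : ℚ) / N) = c n := by
    have : ψ.coeff (ι n) = χ.coeff n := HahnSeries.embDomain_coeff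
    exact this.trans (by simp [χ])
  have hsupp : ψ.support ⊆ Set.range (fun n : ℕ => (n : ℚ) / (N : ℚ)) := fun q hq => by
    by_contra h
    exact hq (HahnSeries.embDomain_of_notMem_range h)
  refine ⟨ψ, isPuiseuxParam_iff.2 ⟨hN, hsupp, ?_⟩, fun q hq => ?_, ?_⟩
  · filter_upwards [hasFPowerSeriesAt_iff.1 hp] with t ht
    rw [zero_add] at ht
    simp only [hcoeff]
    have h0 : (fun n => t ^ (n + R) * c (n + R)) = fun n => t ^ R * (t ^ n • p.coeff n) := by
      funext n
      simp only [c, Nat.add_sub_cancel, smul_eq_mul, if_neg (Nat.not_lt.2 (Nat.le_add_left R n))]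
      ring
    have h1 := (hasSum_nat_add_iff (f := fun n : ℕ => t ^ n * c n) (g := t ^ R * w t) R).1
      (h0 ▸ ht.mul_left (t ^ R))
    rwa [Finset.sum_eq_zero fun n hn => by simp [c, Finset.mem_range.1 hn], add_zero] at h1
  · by_contra h
    obtain ⟨n, rfl⟩ := hsupp h
    simp only at hq h
    rw [div_lt_div_iff_of_pos_right hNQ] at hq
    exact h (by rw [hcoeff]; simp [c, (by exact_mod_cast hq : n < R)])
  · rw [hcoeff]
    simpa [c] using hp.coeff_zero 1

/-! ### Contact orders -/

namespace HahnSeries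

theorem orderTop_sub_eq_of_coeff {φ ψ : HahnSeries ℚ ℂ} {ρ : ℚ}
    (h : ∀ q < ρ, φ.coeff q = ψ.coeff q) (hρ : φ.coeff ρ ≠ ψ.coeff ρ) :
    (φ - ψ).orderTop = ρ := by
  refine le_antisymm (orderTop_le_of_coeff_ne_zero ?_) (le_orderTop_iff_forall.2 fun q hq => ?_)
  · simpa [sub_eq_zero] using hρ
  · simp [h q (WithTop.coe_lt_coe.1 hq)]

/-- A separation from `ψ` that occurs below `ρ` only sees the coefficients below `ρ`. -/
theorem orderTop_sub_congr_left {φ φ' ψ : HahnSeries ℚ ℂ} {ρ q : ℚ}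
    (h : ∀ q < ρ, φ.coeff q = φ'.coeff q) (hq : q < ρ) (hne : φ.coeff q ≠ ψ.coeff q) :
    (φ - ψ).orderTop = (φ' - ψ).orderTop := by
  have hq0 : (φ - ψ).coeff q ≠ 0 := by simpa [sub_eq_zero] using hne
  have hlt : (φ - ψ).order < ρ := (order_le_of_coeff_ne_zero hq0).trans_lt hq
  have h0 : φ - ψ ≠ 0 := ne_zero_of_coeff_ne_zero hq0
  have h1 : (φ - ψ).coeff (φ - ψ).order ≠ 0 := coeff_order_eq_zero.not.2 h0
  rw [← order_eq_orderTop_of_ne_zero h0]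
  refine (orderTop_sub_eq_of_coeff (fun r hr => ?_) ?_).symm
  · rw [← h r (hr.trans hlt)]
    exact sub_eq_zero.1 (by simpa using coeff_eq_zero_of_lt_order hr)
  · rw [← h _ hlt]
    exact sub_ne_zero.1 (by simpa using h1)

end HahnSeries

/-! ### The dominant polynomial -/

/-- Since every `y` has an `N`-th root, the substitution covers a full neighbourhood of the origin.
-/
theorem eventually_eq_zero_of_comp_pow {f : ℂ × ℂ → ℂ} {T : ℂ → ℂ} {N : ℕ} (hN : 0 < N)
    (hT : ContinuousAt T 0) (hT0 : T 0 = 0)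
    (h : ∀ᶠ v in 𝓝 (0 : ℂ × ℂ), f (T v.2 + v.1, v.2 ^ N) = 0) :
    ∀ᶠ p in 𝓝 (0 : ℂ × ℂ), f p = 0 := by
  obtain ⟨ε, hε, hball⟩ := Metric.eventually_nhds_iff.1 h
  obtain ⟨δ, hδ, hTδ⟩ := Metric.continuousAt_iff.1 hT (ε / 2) (by positivity)
  have hm : 0 < min δ ε := lt_min hδ hε
  have h1 : ∀ᶠ p in 𝓝 (0 : ℂ × ℂ), ‖p.1‖ < ε / 2 :=
    (continuous_fst.norm.tendsto' (0 : ℂ × ℂ) 0 (by simp)).eventually_lt_const (by positivity)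
  have h2 : ∀ᶠ p in 𝓝 (0 : ℂ × ℂ), ‖p.2‖ < min δ ε ^ N :=
    (continuous_snd.norm.tendsto' (0 : ℂ × ℂ) 0 (by simp)).eventually_lt_const (by positivity)
  filter_upwards [h1, h2] with p hp1 hp2
  obtain ⟨t, ht⟩ := IsAlgClosed.exists_pow_nat_eq p.2 hN
  have ht' : ‖t‖ < min δ ε := by
    rw [← ht, norm_pow] at hp2
    exact lt_of_pow_lt_pow_left₀ N hm.le hp2
  have hTt : ‖T t‖ < ε / 2 := by
    simpa [hT0] using hTδ (by simpa using ht'.trans_le (min_le_left _ _))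
  have := @hball (p.1 - T t, t) (by
    rw [dist_zero_right, Prod.norm_def]
    refine max_lt ?_ (ht'.trans_le (min_le_right _ _))
    exact (norm_sub_le _ _).trans_lt (by linarith))
  simpa [ht] using this

/-- The chain rule in `w` brings out `t^R`; off `t = 0`, zeros of `∂G₁/∂w` are therefore zeros of
`∂f/∂x`. -/
theorem partialX_eq_of_comp {f G₁ : ℂ × ℂ → ℂ} {T : ℂ → ℂ} {R N e : ℕ} {w : ℂ}
    (h : ∀ᶠ v in 𝓝 (w, (0 : ℂ)), f (T v.2 + v.1 * v.2 ^ R, v.2 ^ N) = v.2 ^ e * G₁ v) :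
    ∀ᶠ v in 𝓝 (w, (0 : ℂ)),
      v.2 ^ R * partialX f (T v.2 + v.1 * v.2 ^ R, v.2 ^ N) = v.2 ^ e * partialX G₁ v := by
  filter_upwards [h.eventually_nhds] with v hv
  have h1 : (fun x : ℂ => f (T v.2 + x * v.2 ^ R, v.2 ^ N)) =ᶠ[𝓝 v.1]
      fun x => v.2 ^ e * G₁ (x, v.2) :=
    (Continuous.tendsto' (f := fun x : ℂ => (x, v.2)) (by fun_prop) v.1 v rfl).eventually hv
  have h2 := h1.deriv_eq
  rw [deriv_const_mul_field] at h2
  rw [partialX, partialX, ← h2]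
  have h3 := deriv_comp_mul_left (v.2 ^ R) (fun x : ℂ => f (T v.2 + x, v.2 ^ N)) v.1
  have h4 := deriv_comp_const_add (fun x : ℂ => f (x, v.2 ^ N)) (T v.2) (v.2 ^ R * v.1)
  simp only [mul_comm v.1, mul_comm _ (v.2 ^ R)]
  rw [h3, h4, smul_eq_mul]

/-- The dominant part of `f` along the arcs `x = φ(y) + w y ^ ρ`: its roots contain the
coefficients at `y ^ ρ` of the roots of `f` that agree with `φ` below `ρ`, and each root of its
derivative extends to a root of `∂f/∂x`. -/
theorem exists_dominant_polynomial {f : ℂ × ℂ → ℂ} (hf : AnalyticAt ℂ f 0)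
    (hfne : ¬ ∀ᶠ p in 𝓝 (0 : ℂ × ℂ), f p = 0) {φ : HahnSeries ℚ ℂ} {N R : ℕ} {a : ℂ → ℂ}
    (hφ : IsPuiseuxParam φ N a) (hφ0 : 0 < φ.orderTop) (hR : 0 < R) :
    ∃ P : Polynomial ℂ, P ≠ 0 ∧
      (∀ ξ : HahnSeries ℚ ℂ, IsNewtonPuiseuxRoot f ξ →
        (∀ q < (R : ℚ) / N, ξ.coeff q = φ.coeff q) → P.IsRoot (ξ.coeff ((R : ℚ) / N))) ∧
      ∀ w, P.derivative ≠ 0 → P.derivative.IsRoot w → ∃ γ : HahnSeries ℚ ℂ,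
        IsNewtonPuiseuxRoot (partialX f) γ ∧
        (∀ q < (R : ℚ) / N, γ.coeff q = φ.coeff q) ∧ γ.coeff ((R : ℚ) / N) = w := by
  have hN : 0 < N := hφ.1
  have hNQ : (0 : ℚ) < N := by exact_mod_cast hN
  have hφ00 : φ.coeff 0 = 0 := HahnSeries.coeff_eq_zero_of_lt_orderTop hφ0
  set ρ : ℚ := (R : ℚ) / N with hρ
  have hρ0 : 0 < ρ := div_pos (by exact_mod_cast hR) hNQ
  obtain ⟨T, hT⟩ : ∃ T, IsPuiseuxParam (HahnSeries.truncLT ρ φ) N T := ⟨_, hφ.truncLT R⟩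
  have hT0 : T 0 = 0 := by
    rw [hT.apply_zero, HahnSeries.coeff_truncLT_of_lt hρ0, hφ00]
  have hTan := hT.analyticAt
  have hT2 : AnalyticAt ℂ (fun v : ℂ × ℂ => T v.2) 0 :=
    AnalyticAt.fun_comp (f := fun v : ℂ × ℂ => v.2) (x := 0) hTan (by fun_prop)
  have hH : AnalyticAt ℂ (fun v : ℂ × ℂ => f (T v.2 + v.1, v.2 ^ N)) 0 :=
    AnalyticAt.fun_comp (f := fun v : ℂ × ℂ => (T v.2 + v.1, v.2 ^ N)) (x := 0)
      (by simpa [hT0, hN.ne', Prod.zero_eq_mk] using hf)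
      ((hT2.fun_add analyticAt_fst).prod (by fun_prop))
  have hHne : ¬ ∀ᶠ v in 𝓝 (0 : ℂ × ℂ), f (T v.2 + v.1, v.2 ^ N) = 0 := fun h =>
    hfne (eventually_eq_zero_of_comp_pow hN hTan.continuousAt hT0 h)
  obtain ⟨b, Q, hb, hQ, hexp⟩ := hH.exists_fst_expansion
  have hex : ∃ i, analyticOrderAt (b i) 0 ≠ ⊤ := by
    by_contra! h
    exact hHne (hH.eventually_eq_zero_of_fst_expansion hQ hexp
      fun i => analyticOrderAt_eq_top.1 (h i))
  have hexe : ∃ e : ℕ, ∃ i : ℕ, (e : ℕ∞) = R * i + (1 : ℕ) * analyticOrderAt (b i) 0 := by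
    obtain ⟨i, hi⟩ := hex
    exact ⟨R * i + analyticOrderNatAt (b i) 0, i, by
      rw [← Nat.cast_analyticOrderNatAt hi]
      push_cast
      ring⟩
  classical
  -- `e` is the least weighted order `R i + ord (b i)`, attained at `j`; this makes `P ≠ 0`.
  set e := Nat.find hexe with he
  obtain ⟨j, hj⟩ := Nat.find_spec hexe
  rw [← he] at hj
  have hle (i : ℕ) : (e : ℕ∞) ≤ R * i + (1 : ℕ) * analyticOrderAt (b i) 0 := by
    by_cases hi : analyticOrderAt (b i) 0 = ⊤
    · simp [hi]
    · rw [← Nat.cast_analyticOrderNatAt hi]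
      have := Nat.find_min' hexe (m := R * i + 1 * analyticOrderNatAt (b i) 0)
        ⟨i, by rw [← Nat.cast_analyticOrderNatAt hi]; push_cast; ring⟩
      exact_mod_cast this
  choose β hβ hbβ hβ0 using fun i => (hb i).exists_comp_pow_mul_pow_eq one_pos i (hle i)
  obtain ⟨G₁, hG₁, hG₁0, hG₁eq⟩ := exists_weighted_quotient (e := e) (hQ (e + 1)) (hexp (e + 1)) hR
    one_pos (e.lt_succ_self.trans_le (Nat.le_mul_of_pos_left _ hR)) hβ fun i _ => hbβ i
  simp only [pow_one] at hG₁eq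
  -- Stopping at degree `e` loses nothing: `R i > e` for `i > e`.
  let P : Polynomial ℂ := ∑ i ∈ Finset.range (e + 1), Polynomial.monomial i (β i 0)
  have hcoeff (i : ℕ) : P.coeff i = if i < e + 1 then β i 0 else 0 := by
    simp [P, Polynomial.coeff_monomial]
  have heval (w : ℂ) : G₁ (w, 0) = P.eval w := by
    simp [P, hG₁0, Polynomial.eval_finsetSum]
  have hje : j ≤ e := by
    have h1 : (j : ℕ∞) ≤ e := by
      rw [hj]
      refine le_trans ?_ le_self_add
      exact_mod_cast Nat.le_mul_of_pos_left j hR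
    exact_mod_cast h1
  have hP : P ≠ 0 := fun h => by
    have h1 := hcoeff j
    rw [h, Polynomial.coeff_zero, if_pos (by omega)] at h1
    exact (hβ0 j).2 hj h1.symm
  refine ⟨P, hP, ?_, fun w hP' hw => ?_⟩
  · rintro ξ ⟨-, L, c, hc, hroot⟩ hξ
    have hL : 0 < L := hc.1
    have hdiff : IsPuiseuxParam (ξ - HahnSeries.truncLT ρ φ) (N * L)
        fun u => c (u ^ N) - T (u ^ L) :=
      (mul_comm L N ▸ hc.comp_pow hN).sub (hT.comp_pow hL)
    have hρ' : ((R * L : ℕ) : ℚ) / ((N * L : ℕ) : ℚ) = ρ := by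
      have : (L : ℚ) ≠ 0 := by exact_mod_cast hL.ne'
      rw [hρ]
      push_cast
      field_simp
    -- In the common parameter `y = u^(N L)`, `ξ` is `T + z(u) y^ρ` with `z 0` its coefficient at
    -- `y^ρ`. Then `G₁(z(u), u^L) = 0` for `u ≠ 0`, and `u → 0` gives `P(z 0) = 0`.
    obtain ⟨z, hz, hz0, hzeq⟩ := hdiff.exists_eq_pow_mul (R := R * L) (by
      rw [hρ']
      intro q hq
      rw [HahnSeries.coeff_sub, HahnSeries.coeff_truncLT_of_lt hq, hξ q hq, sub_self])
    rw [hρ', HahnSeries.coeff_sub, HahnSeries.coeff_truncLT_of_le le_rfl, sub_zero] at hz0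
    have hcont : ContinuousAt (fun u => (z u, u ^ L)) 0 := by
      have := hz.continuousAt
      fun_prop
    have htend : Tendsto (fun u => (z u, u ^ L)) (𝓝 0) (𝓝 (z 0, 0)) := by
      simpa [ContinuousAt, hL.ne'] using hcont
    have huN : Tendsto (fun u : ℂ => u ^ N) (𝓝 0) (𝓝 0) :=
      (continuous_pow N).tendsto' _ _ (zero_pow hN.ne')
    have hzero : ∀ᶠ u in 𝓝[≠] (0 : ℂ), G₁ (z u, u ^ L) = 0 := by
      filter_upwards [nhdsWithin_le_nhds (htend.eventually (hG₁eq (z 0))),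
        nhdsWithin_le_nhds hzeq, nhdsWithin_le_nhds (huN.eventually hroot),
        self_mem_nhdsWithin] with u h1 h2 h3 h4
      have h5 : T (u ^ L) + z u * (u ^ L) ^ R = c (u ^ N) := by
        rw [← pow_mul, mul_comm L R, mul_comm (z u), ← h2]
        ring
      rw [h5, ← pow_mul, mul_comm L N, pow_mul, h3] at h1
      exact (mul_eq_zero.1 h1.symm).resolve_left (pow_ne_zero _ (pow_ne_zero _ h4))
    have hlim : Tendsto (fun u => G₁ (z u, u ^ L)) (𝓝[≠] 0) (𝓝 (G₁ (z 0, 0))) :=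
      ((hG₁ (z 0)).continuousAt.tendsto.comp htend).mono_left nhdsWithin_le_nhds
    have := tendsto_nhds_unique (hlim.congr' hzero) tendsto_const_nhds
    rw [heval, hz0] at this
    exact this
  · have hDan : AnalyticAt ℂ (fun v : ℂ × ℂ => partialX G₁ (w + v.1, v.2)) 0 :=
      AnalyticAt.fun_comp (f := fun v : ℂ × ℂ => (w + v.1, v.2)) (x := 0)
        (by simpa using (hG₁ w).partialX) (by fun_prop)
    have hD0 (z : ℂ) : partialX G₁ (z, 0) = P.derivative.eval z := by
      simp [partialX, heval]
    obtain ⟨M, hM, ζ, hζ, hζ0, hDζ⟩ := hDan.exists_puiseux_branch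
      (P.derivative.rootMultiplicity w)
      (by simpa only [hD0] using Polynomial.analyticOrderAt_eval_add hP' w)
      ((Polynomial.rootMultiplicity_pos hP').2 hw)
    obtain ⟨ψ, hψ, hψlt, hψρ⟩ := AnalyticAt.exists_isPuiseuxParam (w := fun u => w + ζ u)
      (by fun_prop) (Nat.mul_pos hN hM) (R * M)
    have hρ' : ((R * M : ℕ) : ℚ) / ((N * M : ℕ) : ℚ) = ρ := by
      have : (M : ℚ) ≠ 0 := by exact_mod_cast hM.ne'
      rw [hρ]
      push_cast
      field_simp
    rw [hρ'] at hψlt hψρ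
    have hγ := (hT.comp_pow hM).add hψ
    set γ := HahnSeries.truncLT ρ φ + ψ with hγdef
    have hγlt : ∀ q < ρ, γ.coeff q = φ.coeff q := fun q hq => by
      rw [hγdef, HahnSeries.coeff_add, HahnSeries.coeff_truncLT_of_lt hq, hψlt q hq, add_zero]
    refine ⟨γ, ⟨?_, N * M, _, hγ, ?_⟩, hγlt, ?_⟩
    · have h1 : (ρ : WithTop ℚ) ⊓ φ.orderTop ≤ γ.orderTop := by
        refine HahnSeries.le_orderTop_iff_forall.2 fun q hq => ?_
        rw [lt_inf_iff] at hq
        rw [hγlt q (WithTop.coe_lt_coe.1 hq.1), HahnSeries.coeff_eq_zero_of_lt_orderTop hq.2]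
      exact (lt_inf_iff.2 ⟨by exact_mod_cast hρ0, hφ0⟩).trans_le h1
    · have hcont : ContinuousAt (fun u => (w + ζ u, u ^ M)) 0 := by
        have := hζ.continuousAt
        fun_prop
      have htend : Tendsto (fun u => (w + ζ u, u ^ M)) (𝓝 0) (𝓝 (w, 0)) := by
        simpa [ContinuousAt, hM.ne', hζ0] using hcont
      have hzero : ∀ᶠ u in 𝓝[≠] (0 : ℂ),
          partialX f (T (u ^ M) + u ^ (R * M) * (w + ζ u), u ^ (N * M)) = 0 := by
        filter_upwards [nhdsWithin_le_nhds (htend.eventually (partialX_eq_of_comp (hG₁eq w))),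
          nhdsWithin_le_nhds hDζ, self_mem_nhdsWithin] with u h1 h2 h3
        rw [h2, mul_zero] at h1
        have h4 := (mul_eq_zero.1 h1).resolve_left (pow_ne_zero _ (pow_ne_zero _ h3))
        rwa [← pow_mul, ← pow_mul, mul_comm M R, mul_comm M N, mul_comm (w + ζ u)] at h4
      have hcurve : ContinuousAt
          (fun u => (T (u ^ M) + u ^ (R * M) * (w + ζ u), u ^ (N * M))) 0 :=
        hγ.analyticAt.continuousAt.prodMk (by fun_prop)
      have hcurve0 : Tendsto (fun u => (T (u ^ M) + u ^ (R * M) * (w + ζ u), u ^ (N * M)))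
          (𝓝 0) (𝓝 0) := by
        simpa [ContinuousAt, hM.ne', hN.ne', hR.ne', hT0, Prod.zero_eq_mk] using hcurve
      have hlim := (hf.partialX.continuousAt.tendsto.comp hcurve0).mono_left
        (nhdsWithin_le_nhds (s := {0}ᶜ))
      -- Powers of `u` were cancelled, so the point `u = 0` is recovered by continuity.
      have h00 := tendsto_nhds_unique (hlim.congr' hzero) tendsto_const_nhds
      rw [eventually_nhdsWithin_iff] at hzero
      filter_upwards [hzero] with u hu
      by_cases hu0 : u = 0
      · subst hu0
        simpa [hM.ne', hN.ne', hR.ne', hT0, Prod.zero_eq_mk] using h00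
      · exact hu hu0
    · rw [hγdef, HahnSeries.coeff_add, HahnSeries.coeff_truncLT_of_le le_rfl, hψρ, hζ0]
      simp

/-! ### The polar branch -/

theorem corollary3p2 (f : ℂ × ℂ → ℂ) (hf : AnalyticAt ℂ f (0, 0)) (hf0 : f (0, 0) = 0)
    (hfne : ¬ ∀ᶠ p in 𝓝 ((0, 0) : ℂ × ℂ), f p = 0)
    (ξi ξj : HahnSeries ℚ ℂ) (hi : IsNewtonPuiseuxRoot f ξi) (hj : IsNewtonPuiseuxRoot f ξj)
    (hij : ξi ≠ ξj) :
    ∃ γ ∈ polarBranches f,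
      (∀ᶠ g : ℂ in cofinite, ∀ ξk : HahnSeries ℚ ℂ, IsNewtonPuiseuxRoot f ξk →
        (γ - ξk).orderTop = (approxPair ξi ξj g - ξk).orderTop) ∧
      (γ - ξi).orderTop = (ξi - ξj).orderTop ∧ (γ - ξj).orderTop = (ξi - ξj).orderTop := by
  obtain ⟨hi0, Ni, ai, hai, -⟩ := id hi
  obtain ⟨hj0, Nj, aj, haj, -⟩ := id hj
  have hne : ξi - ξj ≠ 0 := sub_ne_zero.2 hij
  have hρtop := HahnSeries.order_eq_orderTop_of_ne_zero hne
  have hρne : (ξi - ξj).coeff (ξi - ξj).order ≠ 0 := HahnSeries.coeff_order_eq_zero.not.2 hne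
  have happrox (g : ℂ) : approxPair ξi ξj g = rhoApprox ξi (ξi - ξj).order g := rfl
  simp only [happrox]
  -- The common denominator `Ni * Nj` puts `ρ` in the form `R / (Ni * Nj)`.
  have hsub := (hai.comp_pow haj.1).sub (mul_comm Nj Ni ▸ haj.comp_pow hai.1)
  obtain ⟨R, hR⟩ := hsub.2.1 hρne
  have hlt : ∀ q < (ξi - ξj).order, ξj.coeff q = ξi.coeff q := fun q hq =>
    (sub_eq_zero.1 (by simpa using HahnSeries.coeff_eq_zero_of_lt_order hq)).symm
  have hcne : ξi.coeff (ξi - ξj).order ≠ ξj.coeff (ξi - ξj).order :=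
    sub_ne_zero.1 (by simpa using hρne)
  have hpos : 0 < (ξi - ξj).order := by
    have h1 : ξi.orderTop ⊓ ξj.orderTop ≤ (ξi - ξj).orderTop :=
      HahnSeries.min_orderTop_le_orderTop_sub
    have h2 := (lt_inf_iff.2 ⟨hi0, hj0⟩).trans_le h1
    rw [← hρtop] at h2
    exact_mod_cast h2
  set ρ := (ξi - ξj).order with hρ
  simp only at hR
  have hR0 : 0 < R := by
    refine Nat.pos_of_ne_zero ?_
    rintro rfl
    simp at hR
    exact hpos.ne hR
  rw [← Prod.zero_eq_mk] at hf hfne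
  obtain ⟨P, hP, hroot, hcrit⟩ :=
    exists_dominant_polynomial hf hfne (hai.comp_pow haj.1) hi0 hR0
  rw [hR] at hroot hcrit
  have hPi := hroot ξi hi fun _ _ => rfl
  have hPj := hroot ξj hj hlt
  obtain ⟨w, hw, hPw⟩ := Polynomial.exists_isRoot_derivative_not_isRoot hP hPi hPj hcne
  have hP' : P.derivative ≠ 0 := fun h0 => by
    obtain ⟨c, rfl⟩ := Polynomial.natDegree_eq_zero.1 (Polynomial.derivative_eq_zero.1 h0)
    exact hPw (by simpa using hPi)
  obtain ⟨γ, hγ, hγlt, hγρ⟩ := hcrit w hP' hw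
  have hγk {ξ : HahnSeries ℚ ℂ} (hξ : IsNewtonPuiseuxRoot f ξ)
      (hξlt : ∀ q < ρ, ξ.coeff q = ξi.coeff q) : (γ - ξ).orderTop = ρ := by
    refine HahnSeries.orderTop_sub_eq_of_coeff (fun q hq => by rw [hγlt q hq, hξlt q hq]) ?_
    rintro h
    exact hPw (by simpa [← h, hγρ] using hroot ξ hξ hξlt)
  refine ⟨γ, ⟨hγ, fun h => hPw (hγρ ▸ hroot γ h hγlt)⟩, ?_, ?_, ?_⟩
  -- The excluded values of `g` are the roots of `P`, a finite set independent of `ξk`.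
  · have hfin : ∀ᶠ g : ℂ in cofinite, ¬ P.IsRoot g := by
      simpa [eventually_cofinite] using Polynomial.finite_setOfPred_isRoot hP
    filter_upwards [hfin] with g hg ξk hk
    have hglt : ∀ q < ρ, (rhoApprox ξi ρ g).coeff q = ξi.coeff q := fun q hq => by
      simp [rhoApprox, HahnSeries.coeff_truncLT_of_lt hq, HahnSeries.coeff_single_of_ne hq.ne]
    have hgρ : (rhoApprox ξi ρ g).coeff ρ = g := by
      simp [rhoApprox, HahnSeries.coeff_truncLT_of_le le_rfl]
    by_cases hkl : ∀ q < ρ, ξk.coeff q = ξi.coeff q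
    · rw [hγk hk hkl]
      refine (HahnSeries.orderTop_sub_eq_of_coeff (fun q hq => by rw [hglt q hq, hkl q hq]) ?_).symm
      rw [hgρ]
      rintro rfl
      exact hg (hroot ξk hk hkl)
    · push Not at hkl
      obtain ⟨q, hq, hne⟩ := hkl
      refine HahnSeries.orderTop_sub_congr_left (fun r hr => by rw [hγlt r hr, hglt r hr]) hq ?_
      rw [hγlt q hq]
      exact hne.symm
  · rw [hγk hi fun _ _ => rfl, hρtop]
  · rw [hγk hj hlt, hρtop]
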